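/- For real $\alpha,\beta>-1$ and an integer $m\ge 0$ let $$P_m^{(\alpha,\beta)}(x)=\frac1{m!}\sum_{k=0}^m\binom mk(m+\alpha+\beta+1)_k\,(\alpha+k+1)_{m-k}\Big(\frac{x-1}2\Big)^k,\qquad (r)_k=r(r+1)\cdots(r+k-1),$$ be the Jacobi polynomial of degree $m$. Let $\alpha>-1$, $\beta>0$, let $n\ge 0$ be an integer, and assume that $P_n^{(\alpha,\beta)}$ and $P_{n+1}^{(\alpha,\beta+1)}$ have no common zeros. Put $$l_n=-1+\frac{2(n+1)(\alpha+n+1)}{(\alpha+\beta+2n+2)(\alpha+\beta+2n+3)}.$$ Then $P_{n+1}^{(\alpha,\beta+1)}$ has $n+1$ simple real zeros $-1<w_1<w_2<\dots<w_{n+1}<1$, and the following hold. (a) For each of the $n+1$ open intervals $(-1,w_1),(w_1,w_2),\dots,(w_n,w_{n+1})$, either the interval contains exactly one zero of $P_n^{(\alpha,\beta)}$, this zero is simple, and the interval does not contain $l_n$; or the interval contains $l_n$ and no zero of $P_n^{(\alpha,\beta)}$. (b) The zeros of $P_n^{(\alpha,\beta)}$ and $P_{n+1}^{(\alpha,\beta+1)}$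 interlace, that is, all zeros of $P_n^{(\alpha,\beta)}$ are real and simple and, written as $x_1<\dots<x_n$, they satisfy $w_1<x_1<w_2<x_2<\dots<x_n<w_{n+1}$, if and only if $w_1>l_n$. -/

import Mathlib

/-- The Jacobi polynomial `P_n^{(α,β)}`, in its standard explicit form
`(1 / n!) ∑_{k ≤ n} (n choose k) (n+α+β+1)_k (α+k+1)_{n-k} ((x - 1) / 2)^k`,
where `(r)_k = r (r + 1) ⋯ (r + k - 1)` is the rising factorial
(equivalently `((α+1)_n / n!) ₂F₁(-n, n+α+β+1; α+1; (1 - x) / 2)` for `α > -1`). -/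
noncomputable def jacobiPoly (n : ℕ) (α β : ℝ) : Polynomial ℝ :=
  Polynomial.C (1 / (n.factorial : ℝ)) *
    ∑ k ∈ Finset.range (n + 1),
      Polynomial.C ((n.choose k : ℝ) *
          (ascPochhammer ℝ k).eval ((n : ℝ) + α + β + 1) *
          (ascPochhammer ℝ (n - k)).eval (α + (k : ℝ) + 1)) *
        (Polynomial.C (1 / 2 : ℝ) * (Polynomial.X - Polynomial.C 1)) ^ k

/-- `z 0 < z 1 < ⋯ < z (m - 1)` is the list of all zeros of `p`, where `p` has degree `m`.
In particular all the zeros of `p` are real and simple. -/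
def IsIncreasingZeros (p : Polynomial ℝ) {m : ℕ} (z : Fin m → ℝ) : Prop :=
  p.natDegree = m ∧ StrictMono z ∧ ∀ x : ℝ, p.IsRoot x ↔ x ∈ Set.range z

/-- The zeros of `p` (of some degree `m`) and of `q` (of degree `m + 1`) interlace: all of them
are real and simple, and `w_1 < x_1 < w_2 < x_2 < ⋯ < x_m < w_{m+1}`, where the `x_i` are the
zeros of `p` and the `w_i` are those of `q`. -/
def ZerosInterlace (p q : Polynomial ℝ) : Prop :=
  ∃ (m : ℕ) (x : Fin m → ℝ) (w : Fin (m + 1) → ℝ),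
    IsIncreasingZeros p x ∧ IsIncreasingZeros q w ∧
      ∀ i : Fin m, w i.castSucc < x i ∧ x i < w i.succ

/-- The open interval `(a, b)` contains either exactly one zero of `p`, which is simple, and not
the point `l`, or the point `l` and no zero of `p`. -/
def OneSimpleZeroOrPoint (p : Polynomial ℝ) (l a b : ℝ) : Prop :=
  ((∃ x : ℝ, {y ∈ Set.Ioo a b | p.IsRoot y} = {x} ∧ p.rootMultiplicity x = 1) ∧
      l ∉ Set.Ioo a b) ∨
    (l ∈ Set.Ioo a b ∧ {y ∈ Set.Ioo a b | p.IsRoot y} = ∅)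

/-- The point `l_n`. -/
noncomputable def jacobiPoint (n : ℕ) (α β : ℝ) : ℝ :=
  -1 + 2 * ((n : ℝ) + 1) * (α + n + 1) / ((α + β + 2 * n + 2) * (α + β + 2 * n + 3))

/-! The product `(x - l_n) P_n^{(α,β)}` has degree `n + 1`, so it suffices to see it alternate in
sign at the `n + 2` points `-1, w_1, …, w_{n+1}`: each gap then holds exactly one zero of it, a
simple one. One of these zeros is `l_n`; the others are the zeros of `P_n^{(α,β)}`. This is (a), and
(b) says that the gap losing its zero must be the first.

The signs at the `w_i` come from `jacobiPoly_mixed_recurrence`: there `P_{n+1}^{(α,β+1)}` drops out,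
and multiplying by `w_i - l_n` produces a square times `P_n^{(α,β+1)}`. The latter alternates at the
`w_i` by a Sturm argument resting on the three-term recurrence; orthogonality is not needed. -/

open Polynomial

/-! ### Hypergeometric coefficients and their ratios. -/

/-- The coefficient of `((x - 1) / 2) ^ k` in the Jacobi polynomial `P_n^{(α,β)}`, where
`s = α + β + 1`. -/
noncomputable def jacobiCoeff (α s : ℝ) (n k : ℕ) : ℝ :=
  (n.choose k : ℝ) * (ascPochhammer ℝ k).eval ((n : ℝ) + s) *
    (ascPochhammer ℝ (n - k)).eval (α + (k : ℝ) + 1) / (n.factorial : ℝ)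

theorem ascPochhammer_eval_succ_left (m : ℕ) (a : ℝ) :
    (ascPochhammer ℝ (m + 1)).eval a = a * (ascPochhammer ℝ m).eval (a + 1) := by
  simp [ascPochhammer_succ_left]

theorem ascPochhammer_eval_add_one_mul (m : ℕ) (a : ℝ) :
    a * (ascPochhammer ℝ m).eval (a + 1) = (ascPochhammer ℝ m).eval a * (a + m) := by
  rw [← ascPochhammer_eval_succ_left, ascPochhammer_succ_eval]

theorem jacobiCoeff_eq_zero (α s : ℝ) {n k : ℕ} (h : n < k) : jacobiCoeff α s n k = 0 := by
  simp [jacobiCoeff, Nat.choose_eq_zero_of_lt h]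

theorem jacobiCoeff_pos {α s : ℝ} (hα : -1 < α) (hs : 0 < s) {n k : ℕ} (h : k ≤ n) :
    0 < jacobiCoeff α s n k := by
  have h1 : (0 : ℝ) < n.choose k := by exact_mod_cast Nat.choose_pos h
  have h2 : 0 < (ascPochhammer ℝ k).eval ((n : ℝ) + s) := ascPochhammer_pos _ _ (by positivity)
  have h3 : 0 < (ascPochhammer ℝ (n - k)).eval (α + (k : ℝ) + 1) :=
    ascPochhammer_pos _ _ (by have : (0 : ℝ) ≤ k := by positivity
                              linarith)
  unfold jacobiCoeff
  positivity

/-- Ratios of hypergeometric terms, here and in the next two lemmas, are kept free of division: no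
factor need be nonzero, and out-of-range indices are covered. -/
theorem jacobiCoeff_succ_right (α s : ℝ) (n j : ℕ) :
    ((j : ℝ) + 1) * (α + j + 1) * jacobiCoeff α s n (j + 1) =
      (n + s + j) * (n - j) * jacobiCoeff α s n j := by
  rcases lt_trichotomy j n with h | rfl | h
  · obtain ⟨m, rfl⟩ := Nat.exists_eq_add_of_lt h
    have hc := Nat.choose_succ_right_eq (j + m + 1) j
    rw [show j + m + 1 - j = m + 1 by omega] at hc
    have hc' : ((j + m + 1).choose (j + 1) : ℝ) * (j + 1) =
        ((j + m + 1).choose j : ℝ) * (m + 1) := by exact_mod_cast hc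
    unfold jacobiCoeff
    rw [show j + m + 1 - j = m + 1 by omega, show j + m + 1 - (j + 1) = m by omega,
      ascPochhammer_succ_eval, ascPochhammer_eval_succ_left m]
    push_cast
    rw [show α + ((j : ℝ) + 1) + 1 = α + j + 1 + 1 by ring]
    linear_combination (α + j + 1) * (ascPochhammer ℝ j).eval ((j : ℝ) + m + 1 + s) *
      ((j : ℝ) + m + 1 + s + j) * (ascPochhammer ℝ m).eval (α + j + 1 + 1) /
        ((j + m + 1).factorial : ℝ) * hc'
  · simp [jacobiCoeff_eq_zero]
  · simp [jacobiCoeff_eq_zero α s h, jacobiCoeff_eq_zero α s (Nat.lt_succ_of_lt h)]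

theorem jacobiCoeff_succ_left (α s : ℝ) (n k : ℕ) :
    ((n : ℝ) + s) * (n + 1 - k) * jacobiCoeff α s (n + 1) k =
      (n + s + k) * (α + n + 1) * jacobiCoeff α s n k := by
  rcases lt_trichotomy k (n + 1) with h | rfl | h
  · obtain ⟨m, rfl⟩ := Nat.exists_eq_add_of_le (Nat.lt_succ_iff.1 h)
    have hc := Nat.choose_mul_succ_eq (k + m) k
    rw [show k + m + 1 - k = m + 1 by omega] at hc
    have hc' : ((k + m).choose k : ℝ) * (k + m + 1) =
        ((k + m + 1).choose k : ℝ) * (m + 1) := by exact_mod_cast hc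
    have hp := ascPochhammer_eval_add_one_mul k ((k : ℝ) + m + s)
    have hf : (((k + m).factorial : ℕ) : ℝ) ≠ 0 := by positivity
    have hk : (k : ℝ) + m + 1 ≠ 0 := by positivity
    unfold jacobiCoeff
    rw [show k + m + 1 - k = m + 1 by omega, show k + m - k = m by omega,
      ascPochhammer_succ_eval, Nat.factorial_succ]
    push_cast
    rw [show (k : ℝ) + m + 1 + s = k + m + s + 1 by ring]
    field_simp
    linear_combination (m + 1) * ((k + m + 1).choose k : ℝ) * (α + k + 1 + m) *
        (ascPochhammer ℝ m).eval (α + k + 1) * hp - (ascPochhammer ℝ m).eval (α + k + 1) *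
        (α + k + 1 + m) * (ascPochhammer ℝ k).eval ((k : ℝ) + m + s) * (k + m + s + k) * hc'
  · simp [jacobiCoeff_eq_zero]
  · simp [jacobiCoeff_eq_zero α s h, jacobiCoeff_eq_zero α s (Nat.lt_of_succ_lt h)]

theorem jacobiCoeff_add_one (α s : ℝ) (n k : ℕ) :
    ((n : ℝ) + s) * jacobiCoeff α (s + 1) n k = (n + s + k) * jacobiCoeff α s n k := by
  have hp := ascPochhammer_eval_add_one_mul k ((n : ℝ) + s)
  unfold jacobiCoeff
  rw [← add_assoc]
  linear_combination (n.choose k : ℝ) * (ascPochhammer ℝ (n - k)).eval (α + k + 1) /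
    (n.factorial : ℝ) * hp

/-! ### Degree, leading coefficient and value at `1`. -/

/-- The Jacobi polynomial in the variable `(x - 1) / 2`. -/
noncomputable def shiftedJacobi (α s : ℝ) (n : ℕ) : ℝ[X] :=
  ∑ k ∈ Finset.range (n + 1), monomial k (jacobiCoeff α s n k)

theorem coeff_shiftedJacobi (α s : ℝ) (n k : ℕ) :
    (shiftedJacobi α s n).coeff k = jacobiCoeff α s n k := by
  simp only [shiftedJacobi, finsetSum_coeff, coeff_monomial]
  rw [Finset.sum_ite_eq']
  split_ifs with h
  · rfl
  · rw [jacobiCoeff_eq_zero]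
    simpa using h

theorem jacobiPoly_eq_comp (n : ℕ) (α β : ℝ) :
    jacobiPoly n α β = (shiftedJacobi α (α + β + 1) n).comp (C (1 / 2 : ℝ) * (X - C 1)) := by
  unfold jacobiPoly shiftedJacobi jacobiCoeff
  rw [Polynomial.sum_comp, Finset.mul_sum]
  refine Finset.sum_congr rfl fun k _ => ?_
  rw [monomial_comp, ← mul_assoc, ← C_mul]
  congr 2
  rw [← add_assoc, ← add_assoc]
  ring

theorem eval_jacobiPoly (n : ℕ) (α β x : ℝ) :
    (jacobiPoly n α β).eval x = (shiftedJacobi α (α + β + 1) n).eval ((x - 1) / 2) := by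
  rw [jacobiPoly_eq_comp, eval_comp]
  congr 1
  simp
  ring

theorem natDegree_shiftedJacobi {α s : ℝ} (hα : -1 < α) (hs : 0 < s) (n : ℕ) :
    (shiftedJacobi α s n).natDegree = n := by
  refine natDegree_eq_of_le_of_coeff_ne_zero ?_ ?_
  · rw [natDegree_le_iff_coeff_eq_zero]
    intro k hk
    rw [coeff_shiftedJacobi, jacobiCoeff_eq_zero α s hk]
  · rw [coeff_shiftedJacobi]
    exact (jacobiCoeff_pos hα hs le_rfl).ne'

theorem natDegree_half_mul_X_sub_one :
    (C (1 / 2 : ℝ) * (X - C 1)).natDegree = 1 := by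
  rw [natDegree_C_mul (by norm_num), natDegree_X_sub_C]

theorem natDegree_jacobiPoly {α β : ℝ} (hα : -1 < α) (hs : 0 < α + β + 1) (n : ℕ) :
    (jacobiPoly n α β).natDegree = n := by
  rw [jacobiPoly_eq_comp, natDegree_comp, natDegree_shiftedJacobi hα hs,
    natDegree_half_mul_X_sub_one, mul_one]

theorem leadingCoeff_jacobiPoly_pos {α β : ℝ} (hα : -1 < α) (hs : 0 < α + β + 1) (n : ℕ) :
    0 < (jacobiPoly n α β).leadingCoeff := by
  rw [jacobiPoly_eq_comp, leadingCoeff_comp (by rw [natDegree_half_mul_X_sub_one]; norm_num),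
    leadingCoeff, natDegree_shiftedJacobi hα hs, coeff_shiftedJacobi, leadingCoeff_mul,
    leadingCoeff_X_sub_C, leadingCoeff_C]
  have := jacobiCoeff_pos hα hs (le_refl n)
  positivity

theorem eval_one_jacobiPoly_pos {α β : ℝ} (hα : -1 < α) (hs : 0 < α + β + 1) (n : ℕ) :
    0 < (jacobiPoly n α β).eval 1 := by
  rw [eval_jacobiPoly, sub_self, zero_div, ← coeff_zero_eq_eval_zero, coeff_shiftedJacobi]
  exact jacobiCoeff_pos hα hs (Nat.zero_le n)

theorem eval_jacobiPoly_zero (α β x : ℝ) : (jacobiPoly 0 α β).eval x = 1 := by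
  simp [jacobiPoly]

theorem eval_jacobiPoly_one (α β x : ℝ) :
    (jacobiPoly 1 α β).eval x = α + 1 + (α + β + 2) * ((x - 1) / 2) := by
  simp [jacobiPoly, Finset.sum_range_succ]
  ring

/-! ### Three-term recurrence and value at `-1`. -/

theorem shiftedJacobi_recurrence {α s : ℝ} (hα : -1 < α) (hs : 0 < s) (n : ℕ) :
    C (2 * ((n : ℝ) + 2) * (n + 1 + s) * (2 * n + 1 + s)) * shiftedJacobi α s (n + 2) =
      C (2 * (2 * (n : ℝ) + 2 + s) * (2 * n + 3 + s) * (2 * n + 1 + s)) *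
          (X * shiftedJacobi α s (n + 1)) +
        C ((2 * (n : ℝ) + 2 + s) * ((2 * n + 3 + s) * (2 * n + 1 + s) + α ^ 2 -
          (s - α - 1) ^ 2)) * shiftedJacobi α s (n + 1) -
        C (2 * ((n : ℝ) + 1 + α) * (n + s - α) * (2 * n + 3 + s)) * shiftedJacobi α s n := by
  have hn : (0 : ℝ) ≤ n := by positivity
  have h1 : (n : ℝ) + 1 + s ≠ 0 := by positivity
  have h2 : α + n + 1 ≠ 0 := by linarith
  ext k
  simp only [coeff_sub, coeff_add, coeff_C_mul, coeff_shiftedJacobi]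
  rcases k with _ | j
  · simp only [coeff_X_mul_zero]
    have e1 := jacobiCoeff_succ_left α s n 0
    have e2 := jacobiCoeff_succ_left α s (n + 1) 0
    push_cast at e1 e2
    have h3 : (n : ℝ) + s ≠ 0 := by positivity
    have e1' : jacobiCoeff α s n 0 = (n + 1) / (α + n + 1) * jacobiCoeff α s (n + 1) 0 := by
      field_simp
      apply mul_left_cancel₀ h3
      linear_combination -e1
    have e2' : jacobiCoeff α s (n + 2) 0 =
        (α + n + 2) / (n + 2) * jacobiCoeff α s (n + 1) 0 := by
      field_simp
      apply mul_left_cancel₀ h1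
      linear_combination e2
    rw [e1', e2']
    field_simp
    ring
  · simp only [coeff_X_mul, coeff_shiftedJacobi]
    have hj : (0 : ℝ) ≤ j := by positivity
    have h3 : (n : ℝ) + s + (j + 1) ≠ 0 := by positivity
    have h4 : (j : ℝ) + 1 ≠ 0 := by positivity
    have h5 : α + j + 1 ≠ 0 := by linarith
    have e1 := jacobiCoeff_succ_left α s n (j + 1)
    have e2 := jacobiCoeff_succ_left α s (n + 1) j
    have e3 := jacobiCoeff_succ_right α s (n + 1) j
    have e4 := jacobiCoeff_succ_right α s (n + 2) j
    push_cast at e1 e2 e3 e4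
    -- Each term becomes a rational multiple of `jacobiCoeff α s (n + 1) j`, leaving a rational
    -- identity.
    have e3' : jacobiCoeff α s (n + 1) (j + 1) =
        (n + 1 + s + j) * (n + 1 - j) / ((j + 1) * (α + j + 1)) *
          jacobiCoeff α s (n + 1) j := by
      field_simp
      linear_combination e3
    have e1' : jacobiCoeff α s n (j + 1) =
        (n + s) * (n - j) * (n + 1 - j) / ((α + n + 1) * ((j + 1) * (α + j + 1))) *
          jacobiCoeff α s (n + 1) j := by
      rw [e3'] at e1
      field_simp at e1 ⊢
      apply mul_left_cancel₀ h3
      linear_combination -e1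
    have e2' : jacobiCoeff α s (n + 2) (j + 1) =
        (n + 2 + s + j) * (n + 1 + s + j) * (α + n + 2) /
          ((n + 1 + s) * ((j + 1) * (α + j + 1))) * jacobiCoeff α s (n + 1) j := by
      field_simp
      linear_combination (n + 1 + s) * e4 + (n + 2 + s + j) * e2
    rw [e1', e2', e3']
    field_simp
    ring

theorem jacobiPoly_recurrence {α β : ℝ} (hα : -1 < α) (hs : 0 < α + β + 1) (n : ℕ) (x : ℝ) :
    2 * ((n : ℝ) + 2) * (n + 2 + α + β) * (2 * n + 2 + α + β) * (jacobiPoly (n + 2) α β).eval x =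
      (2 * (n : ℝ) + 3 + α + β) * ((2 * n + 4 + α + β) * (2 * n + 2 + α + β) * x +
        α ^ 2 - β ^ 2) * (jacobiPoly (n + 1) α β).eval x -
        2 * ((n : ℝ) + 1 + α) * (n + 1 + β) * (2 * n + 4 + α + β) *
          (jacobiPoly n α β).eval x := by
  have h := congrArg (eval ((x - 1) / 2)) (shiftedJacobi_recurrence hα hs n)
  simp only [eval_sub, eval_add, eval_mul, eval_C, eval_X, ← eval_jacobiPoly] at h
  linear_combination h

/-- The defining expansion is centred at `1` and hides this value; the recurrence yields it by
two-step induction. -/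
theorem eval_neg_one_jacobiPoly {α β : ℝ} (hα : -1 < α) (hs : 0 < α + β + 1) (n : ℕ) :
    (jacobiPoly n α β).eval (-1) =
      (-1) ^ n * (ascPochhammer ℝ n).eval (β + 1) / (n.factorial : ℝ) := by
  induction n using Nat.twoStepInduction with
  | zero => simp [eval_jacobiPoly_zero]
  | one =>
    simp [eval_jacobiPoly_one]
    ring
  | more n h0 h1 =>
    have hn : (0 : ℝ) ≤ n := by positivity
    have h := jacobiPoly_recurrence hα hs n (-1)
    have h2 : 2 * ((n : ℝ) + 2) * (n + 2 + α + β) * (2 * n + 2 + α + β) ≠ 0 := by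
      have : 0 < (n : ℝ) + 2 + α + β := by linarith
      have : 0 < 2 * (n : ℝ) + 2 + α + β := by linarith
      positivity
    apply mul_left_cancel₀ h2
    rw [h, h0, h1, ascPochhammer_succ_eval (n + 1), ascPochhammer_succ_eval n,
      Nat.factorial_succ (n + 1), Nat.factorial_succ n]
    have hf : ((n.factorial : ℕ) : ℝ) ≠ 0 := by positivity
    have h3 : (n : ℝ) + 1 ≠ 0 := by positivity
    have h4 : (n : ℝ) + 1 + 1 ≠ 0 := by positivity
    push_cast
    field_simp
    ring

theorem eval_neg_one_jacobiPoly_sign {α β : ℝ} (hα : -1 < α) (hβ : -1 < β)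
    (hs : 0 < α + β + 1) (n : ℕ) : 0 < (-1) ^ n * (jacobiPoly n α β).eval (-1) := by
  rw [eval_neg_one_jacobiPoly hα hs, mul_div_assoc, ← mul_assoc, ← mul_pow]
  have := ascPochhammer_pos n (β + 1) (by linarith)
  simp only [mul_neg, mul_one, neg_neg, one_pow, one_mul]
  positivity

/-! ### Mixed relation between the parameters `β` and `β + 1`. -/

theorem shiftedJacobi_mixed {α s : ℝ} (hα : -1 < α) (hs : 0 < s) (n : ℕ) :
    C (((n : ℝ) + s - α) * (2 * n + s + 2)) * shiftedJacobi α s n =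
      C ((2 * (n : ℝ) + s + 1) * (2 * n + s + 2)) * (X * shiftedJacobi α (s + 1) n) +
      C ((2 * (n : ℝ) + s + 1) * (2 * n + s + 2) - (n + 1) * (α + n + 1)) *
        shiftedJacobi α (s + 1) n -
      C (((n : ℝ) + s + 1) * (n + 1)) * shiftedJacobi α (s + 1) (n + 1) := by
  have hn : (0 : ℝ) ≤ n := by positivity
  have h1 : (n : ℝ) + s ≠ 0 := by positivity
  have h6 : (n : ℝ) + s + 1 ≠ 0 := by positivity
  ext k
  simp only [coeff_sub, coeff_add, coeff_C_mul, coeff_shiftedJacobi]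
  have e0 := jacobiCoeff_add_one α s n k
  rcases k with _ | j
  · simp only [coeff_X_mul_zero]
    have e1 := jacobiCoeff_succ_left α (s + 1) n 0
    push_cast at e0 e1
    have e0' : jacobiCoeff α s n 0 = jacobiCoeff α (s + 1) n 0 := by
      apply mul_left_cancel₀ h1
      linear_combination -e0
    have e1' : jacobiCoeff α (s + 1) (n + 1) 0 =
        (α + n + 1) / (n + 1) * jacobiCoeff α (s + 1) n 0 := by
      field_simp
      apply mul_left_cancel₀ h6
      linear_combination e1
    rw [e0', e1']
    field_simp
    ring
  · simp only [coeff_X_mul, coeff_shiftedJacobi]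
    have hj : (0 : ℝ) ≤ j := by positivity
    have h3 : (n : ℝ) + s + (j + 1) ≠ 0 := by positivity
    have h4 : (j : ℝ) + 1 ≠ 0 := by positivity
    have h5 : α + j + 1 ≠ 0 := by linarith
    have e2 := jacobiCoeff_succ_left α (s + 1) n j
    have e3 := jacobiCoeff_succ_right α (s + 1) n j
    have e4 := jacobiCoeff_succ_right α (s + 1) (n + 1) j
    push_cast at e0 e2 e3 e4
    have e3' : jacobiCoeff α (s + 1) n (j + 1) =
        (n + s + 1 + j) * (n - j) / ((j + 1) * (α + j + 1)) * jacobiCoeff α (s + 1) n j := by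
      field_simp
      linear_combination e3
    have e0' : jacobiCoeff α s n (j + 1) =
        (n + s) * (n - j) / ((j + 1) * (α + j + 1)) * jacobiCoeff α (s + 1) n j := by
      rw [e3'] at e0
      field_simp at e0 ⊢
      apply mul_left_cancel₀ h3
      linear_combination -e0
    have e2' : jacobiCoeff α (s + 1) (n + 1) (j + 1) =
        (n + s + 2 + j) * (n + s + 1 + j) * (α + n + 1) /
          ((n + s + 1) * ((j + 1) * (α + j + 1))) * jacobiCoeff α (s + 1) n j := by
      field_simp
      linear_combination (n + s + 1) * e4 + (n + s + 2 + j) * e2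
    rw [e0', e2', e3']
    field_simp
    ring

/-- The relation expressing `P_n^{(α,β)}` through `P_n^{(α,β+1)}` and `P_{n+1}^{(α,β+1)}`, in
which `x - l_n` is the factor of `P_n^{(α,β+1)}`. -/
theorem jacobiPoly_mixed_recurrence {α β : ℝ} (hα : -1 < α) (hs : 0 < α + β + 1) (n : ℕ)
    (x : ℝ) :
    ((n : ℝ) + β + 1) * (α + β + 2 * n + 3) * (jacobiPoly n α β).eval x =
      (α + β + 2 * n + 2) * (α + β + 2 * n + 3) / 2 * (x - jacobiPoint n α β) *
          (jacobiPoly n α (β + 1)).eval x -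
        ((n : ℝ) + α + β + 2) * (n + 1) * (jacobiPoly (n + 1) α (β + 1)).eval x := by
  have hn : (0 : ℝ) ≤ n := by positivity
  have h1 : α + β + 2 * n + 2 ≠ 0 := by linarith
  have h2 : α + β + 2 * n + 3 ≠ 0 := by linarith
  have h := congrArg (eval ((x - 1) / 2)) (shiftedJacobi_mixed hα hs n)
  rw [show α + β + 1 + 1 = α + (β + 1) + 1 by ring] at h
  simp only [eval_sub, eval_add, eval_mul, eval_C, eval_X, ← eval_jacobiPoly] at h
  have hl : (α + β + 2 * n + 2) * (α + β + 2 * n + 3) / 2 * (x - jacobiPoint n α β) =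
      (α + β + 2 * n + 2) * (α + β + 2 * n + 3) * (x + 1) / 2 - (n + 1) * (α + n + 1) := by
    unfold jacobiPoint
    field_simp
    ring
  rw [hl]
  linear_combination h

/-! ### Zeros from sign changes, and signs from zeros. -/

theorem lt_of_forall_lt_succ {e : ℕ → ℝ} {m : ℕ} (he : ∀ i < m, e i < e (i + 1)) {i j : ℕ}
    (hij : i < j) (hj : j ≤ m) : e i < e j := by
  induction j, hij using Nat.le_induction with
  | base => exact he i hj
  | succ j _ ih => exact (ih (by omega)).trans (he j (by omega))

theorem le_of_forall_lt_succ {e : ℕ → ℝ} {m : ℕ} (he : ∀ i < m, e i < e (i + 1)) {i j : ℕ}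
    (hij : i ≤ j) (hj : j ≤ m) : e i ≤ e j := by
  rcases hij.eq_or_lt with rfl | h
  · exact le_rfl
  · exact (lt_of_forall_lt_succ he h hj).le

theorem exists_eval_eq_zero_of_mul_neg (f : ℝ[X]) {a b : ℝ} (hab : a < b)
    (h : f.eval a * f.eval b < 0) : ∃ x, a < x ∧ x < b ∧ f.eval x = 0 := by
  have hc : ContinuousOn (fun x => f.eval x) (Set.Icc a b) := f.continuous.continuousOn
  rcases mul_neg_iff.1 h with ⟨h1, h2⟩ | ⟨h1, h2⟩
  · obtain ⟨x, hx, h0⟩ := intermediate_value_Ioo' hab.le hc ⟨h2, h1⟩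
    exact ⟨x, hx.1, hx.2, h0⟩
  · obtain ⟨x, hx, h0⟩ := intermediate_value_Ioo hab.le hc ⟨h1, h2⟩
    exact ⟨x, hx.1, hx.2, h0⟩

/-- Only the parity of `N` matters: it fixes the sign at `e 0`. -/
theorem exists_roots_of_alternating (f : ℝ[X]) {e : ℕ → ℝ} {m N : ℕ}
    (he : ∀ i < m, e i < e (i + 1)) (hs : ∀ i ≤ m, 0 < (-1) ^ (N + i) * f.eval (e i)) :
    ∃ y : ℕ → ℝ, ∀ i < m, e i < y i ∧ y i < e (i + 1) ∧ f.eval (y i) = 0 := by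
  have h : ∀ i, ∃ x, i < m → e i < x ∧ x < e (i + 1) ∧ f.eval x = 0 := by
    intro i
    by_cases hi : i < m
    · obtain ⟨x, hx⟩ := exists_eval_eq_zero_of_mul_neg f (he i hi) (by
        have h2 := mul_pos (hs i hi.le) (hs (i + 1) hi)
        have h3 : ((-1 : ℝ) ^ (N + i)) * (-1) ^ (N + i) = 1 := by
          rw [← mul_pow]
          simp
        have h4 : (-1) ^ (N + i) * f.eval (e i) * ((-1) ^ (N + (i + 1)) * f.eval (e (i + 1))) =
            -(f.eval (e i) * f.eval (e (i + 1))) := by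
          rw [← add_assoc, pow_succ]
          linear_combination -(f.eval (e i) * f.eval (e (i + 1))) * h3
        linarith)
      exact ⟨x, fun _ => hx⟩
    · exact ⟨0, fun h => absurd h hi⟩
  choose y hy using h
  exact ⟨y, hy⟩

/-- As many distinct zeros as the degree exhaust the root multiset, so all are simple. -/
theorem Polynomial.roots_eq_map_of_injOn {ι : Type*} {p : ℝ[X]} (hp : p ≠ 0) (s : Finset ι)
    (hdeg : p.natDegree = s.card) {y : ι → ℝ} (hinj : Set.InjOn y s)
    (hy : ∀ i ∈ s, p.eval (y i) = 0) : p.roots = s.val.map y := by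
  symm
  refine Multiset.eq_of_le_of_card_le ?_ ?_
  · rw [Multiset.le_iff_subset (Multiset.Nodup.map_on (fun a ha b hb h => hinj ha hb h) s.nodup)]
    intro x hx
    obtain ⟨i, hi, rfl⟩ := Multiset.mem_map.1 hx
    exact (mem_roots hp).2 (hy i hi)
  · rw [Multiset.card_map]
    exact (card_roots' p).trans hdeg.le

/-- In the linear factorisation exactly `m - j` factors are negative at `x`; the exponent `m + j`
has the same parity. -/
theorem Polynomial.eval_sign_of_roots {p : ℝ[X]} {m : ℕ} (hdeg : p.natDegree = m)
    (hlc : 0 < p.leadingCoeff) {z : ℕ → ℝ} (hinj : Set.InjOn z (Finset.range m))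
    (hz : ∀ i < m, p.eval (z i) = 0) {j : ℕ} (hj : j ≤ m) {x : ℝ}
    (hlt : ∀ i < j, z i < x) (hgt : ∀ i, j ≤ i → i < m → x < z i) :
    0 < (-1) ^ (m + j) * p.eval x := by
  have hp : p ≠ 0 := by
    rintro rfl
    simp at hlc
  have hr := roots_eq_map_of_injOn hp (Finset.range m) (by simpa using hdeg) hinj
    (fun i hi => hz i (Finset.mem_range.1 hi))
  have hprod := C_leadingCoeff_mul_prod_multiset_X_sub_C (p := p) (by rw [hr]; simp [hdeg])
  rw [hr, Multiset.map_map] at hprod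
  have he : p.eval x = p.leadingCoeff * ∏ i ∈ Finset.range m, (x - z i) := by
    have := congrArg (eval x) hprod
    rw [eval_mul, eval_C] at this
    rw [← this]
    congr 1
    change eval x (∏ i ∈ Finset.range m, (X - C (z i))) = _
    rw [eval_prod]
    simp
  obtain ⟨k, rfl⟩ := Nat.exists_eq_add_of_le hj
  rw [he, Finset.prod_range_add]
  have h1 : 0 < ∏ i ∈ Finset.range j, (x - z i) :=
    Finset.prod_pos fun i hi => sub_pos.2 (hlt i (Finset.mem_range.1 hi))
  have h2 : 0 < ∏ i ∈ Finset.range k, (z (j + i) - x) :=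
    Finset.prod_pos fun i hi => sub_pos.2
      (hgt _ (by omega) (by have := Finset.mem_range.1 hi; omega))
  have h3 : ∏ i ∈ Finset.range k, (x - z (j + i)) =
      (-1) ^ k * ∏ i ∈ Finset.range k, (z (j + i) - x) := by
    rw [← Finset.card_range k, ← Finset.prod_const, Finset.card_range,
      ← Finset.prod_mul_distrib]
    exact Finset.prod_congr rfl fun i _ => by ring
  have h4 : (-1 : ℝ) ^ (j + k + j) * (-1) ^ k = 1 := by
    rw [← pow_add]
    exact Even.neg_one_pow ⟨j + k, by ring⟩
  rw [h3, show (-1 : ℝ) ^ (j + k + j) * (p.leadingCoeff * ((∏ i ∈ Finset.range j, (x - z i)) *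
      ((-1) ^ k * ∏ i ∈ Finset.range k, (z (j + i) - x)))) = ((-1 : ℝ) ^ (j + k + j) * (-1) ^ k) *
      (p.leadingCoeff * ((∏ i ∈ Finset.range j, (x - z i)) *
      ∏ i ∈ Finset.range k, (z (j + i) - x))) by ring, h4]
  positivity

/-! ### Sturm sequences. -/

/-- A sequence of polynomials satisfying a Sturm type condition on `[-1, 1]`. -/
structure IsSturmSequence (p : ℕ → ℝ[X]) : Prop where
  natDegree_eq : ∀ n, (p n).natDegree = n
  leadingCoeff_pos : ∀ n, 0 < (p n).leadingCoeff
  eval_neg_one : ∀ n, 0 < (-1) ^ n * (p n).eval (-1)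
  eval_one : ∀ n, 0 < (p n).eval 1
  eval_of_root : ∀ n x, (p (n + 1)).eval x = 0 →
    ∃ c > 0, (p (n + 2)).eval x = -(c * (p n).eval x)

namespace IsSturmSequence

variable {p : ℕ → ℝ[X]}

/-- Inductive step: the zeros of `p n` together with `±1` are `n + 2` points where `p (n + 1)`
alternates. The new zeros separate the old ones, which determines the sign of `p n` at them. -/
theorem exists_roots_of_signs (hp : IsSturmSequence p) {n : ℕ} {z : ℕ → ℝ}
    (hz : ∀ i < n, -1 < z i ∧ z i < 1 ∧ (p n).eval (z i) = 0 ∧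
      0 < (-1) ^ (n + i) * (p (n + 1)).eval (z i))
    (hmono : ∀ i, i + 1 < n → z i < z (i + 1)) :
    ∃ y : ℕ → ℝ, (∀ i < n + 1, -1 < y i ∧ y i < 1 ∧ (p (n + 1)).eval (y i) = 0 ∧
      0 < (-1) ^ (n + i) * (p n).eval (y i)) ∧ ∀ i, i + 1 < n + 1 → y i < y (i + 1) := by
  let e : ℕ → ℝ := fun j => Nat.casesOn j (-1) (fun i => if i < n then z i else 1)
  have e0 : e 0 = -1 := rfl
  have es : ∀ i < n, e (i + 1) = z i := fun i hi => if_pos hi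
  have en : e (n + 1) = 1 := if_neg (lt_irrefl n)
  have he : ∀ i < n + 1, e i < e (i + 1) := by
    intro i hi
    rcases (Nat.lt_succ_iff.1 hi).eq_or_lt with rfl | hi
    · rw [en]
      rcases i with _ | i
      · rw [e0]; norm_num
      · rw [es i (by omega)]
        exact (hz i (by omega)).2.1
    · rw [es i hi]
      rcases i with _ | i
      · rw [e0]
        exact (hz 0 hi).1
      · rw [es i (by omega)]
        exact hmono i hi
  have hs : ∀ i ≤ n + 1, 0 < (-1) ^ (n + 1 + i) * (p (n + 1)).eval (e i) := by
    intro i hi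
    rcases i with _ | i
    · exact hp.eval_neg_one (n + 1)
    · rcases (Nat.succ_le_succ_iff.1 hi).eq_or_lt with rfl | hi
      · rw [en, Even.neg_one_pow ⟨i + 1, rfl⟩, one_mul]
        exact hp.eval_one _
      · rw [es i hi]
        have := (hz i hi).2.2.2
        rwa [show n + 1 + (i + 1) = n + i + 2 by ring, pow_add, neg_one_sq, mul_one]
  obtain ⟨y, hy⟩ := exists_roots_of_alternating _ he hs
  refine ⟨y, fun i hi => ⟨?_, ?_, (hy i hi).2.2, ?_⟩, fun i hi => ?_⟩
  · exact (le_of_forall_lt_succ he (Nat.zero_le i) (by omega)).trans_lt (hy i hi).1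
  · rw [← en]
    exact (hy i hi).2.1.trans_le (le_of_forall_lt_succ he (Nat.succ_le_of_lt hi) le_rfl)
  · refine eval_sign_of_roots (z := z) (hp.natDegree_eq n) (hp.leadingCoeff_pos n) ?_
      (fun k hk => (hz k hk).2.2.1) (by omega) ?_ ?_
    · intro a ha b hb hab
      simp only [Finset.coe_range, Set.mem_Iio] at ha hb
      rw [← es a ha, ← es b hb] at hab
      rcases lt_trichotomy a b with h | h | h
      · exact absurd hab (lt_of_forall_lt_succ he (Nat.succ_lt_succ h) (by omega)).ne
      · exact h
      · exact absurd hab (lt_of_forall_lt_succ he (Nat.succ_lt_succ h) (by omega)).ne'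
    · intro k hk
      rw [← es k (by omega)]
      exact (le_of_forall_lt_succ he (Nat.succ_le_of_lt hk) hi.le).trans_lt (hy i hi).1
    · intro k hk hk'
      rw [← es k hk']
      exact (hy i hi).2.1.trans_le
        (le_of_forall_lt_succ he (Nat.succ_le_succ hk) (Nat.succ_lt_succ hk').le)
  · exact (hy i (by omega)).2.1.trans (hy (i + 1) hi).1

/-- All zeros of `p (n + 1)` are real, simple and lie in `(-1, 1)`, and `p n` alternates in sign
at them. -/
theorem exists_roots (hp : IsSturmSequence p) (n : ℕ) :
    ∃ y : ℕ → ℝ, (∀ i < n + 1, -1 < y i ∧ y i < 1 ∧ (p (n + 1)).eval (y i) = 0 ∧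
      0 < (-1) ^ (n + i) * (p n).eval (y i)) ∧ ∀ i, i + 1 < n + 1 → y i < y (i + 1) := by
  induction n with
  -- `p 0` has no zeros, so `z` is a dummy.
  | zero => exact hp.exists_roots_of_signs (z := 0) (by simp) (by simp)
  | succ n ih =>
    obtain ⟨z, hz, hmono⟩ := ih
    refine hp.exists_roots_of_signs (z := z) (fun i hi => ?_) hmono
    obtain ⟨h1, h2, h3, h4⟩ := hz i hi
    refine ⟨h1, h2, h3, ?_⟩
    obtain ⟨c, hc, h⟩ := hp.eval_of_root n _ h3
    rw [h, show n + 1 + i = n + i + 1 by ring, pow_succ]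
    -- At a zero of `p (n + 1)`, `p (n + 2)` and `p n` have opposite signs.
    have := mul_pos hc h4
    linarith

end IsSturmSequence

/-- At a zero of `P_{n+1}` the middle term of the recurrence vanishes, and the two outer
coefficients are positive. -/
theorem isSturmSequence_jacobiPoly {α β : ℝ} (hα : -1 < α) (hβ : -1 < β)
    (hs : 0 < α + β + 1) : IsSturmSequence fun n => jacobiPoly n α β where
  natDegree_eq := natDegree_jacobiPoly hα hs
  leadingCoeff_pos := leadingCoeff_jacobiPoly_pos hα hs
  eval_neg_one := eval_neg_one_jacobiPoly_sign hα hβ hs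
  eval_one := eval_one_jacobiPoly_pos hα hs
  eval_of_root n x hx := by
    have hn : (0 : ℝ) ≤ n := by positivity
    have h := jacobiPoly_recurrence hα hs n x
    rw [hx, mul_zero, zero_sub] at h
    have h1 : 0 < (n : ℝ) + 2 + α + β := by linarith
    have h2 : 0 < 2 * (n : ℝ) + 2 + α + β := by linarith
    have h3 : 0 < (n : ℝ) + 1 + α := by linarith
    have h4 : 0 < (n : ℝ) + 1 + β := by linarith
    have h5 : 0 < 2 * (n : ℝ) + 4 + α + β := by linarith
    refine ⟨2 * ((n : ℝ) + 1 + α) * (n + 1 + β) * (2 * n + 4 + α + β) /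
      (2 * ((n : ℝ) + 2) * (n + 2 + α + β) * (2 * n + 2 + α + β)), by positivity, ?_⟩
    rw [div_mul_eq_mul_div, ← neg_div, eq_div_iff (by positivity)]
    linear_combination h

/-! ### From zeros of `(X - l) p` to zeros of `p`, and interlacing. -/

/-- If `(X - l) p` has exactly one zero, a simple one, in each of the intervals given by `e`,
then so has `p`, except in the interval containing `l`. -/
theorem oneSimpleZeroOrPoint_of_roots {p : ℝ[X]} {l : ℝ} {n : ℕ} (hp : p ≠ 0)
    (hdeg : p.natDegree = n) {e y : ℕ → ℝ} (he : ∀ i < n + 1, e i < e (i + 1))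
    (hy : ∀ i < n + 1, e i < y i ∧ y i < e (i + 1) ∧ ((X - C l) * p).eval (y i) = 0)
    {j : ℕ} (hj : j < n + 1) : OneSimpleZeroOrPoint p l (e j) (e (j + 1)) := by
  have hg : (X - C l) * p ≠ 0 := mul_ne_zero (X_sub_C_ne_zero l) hp
  have hlt : ∀ a b, a < b → b < n + 1 → y a < y b := fun a b hab hb =>
    ((hy a (by omega)).2.1.trans_le (le_of_forall_lt_succ he hab hb.le)).trans (hy b hb).1
  have hinj : Set.InjOn y (Finset.range (n + 1)) := by
    intro a ha b hb hab
    simp only [Finset.coe_range, Set.mem_Iio] at ha hb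
    rcases lt_trichotomy a b with h | h | h
    · exact absurd hab (hlt a b h hb).ne
    · exact h
    · exact absurd hab (hlt b a h ha).ne'
  have hr := roots_eq_map_of_injOn hg (Finset.range (n + 1))
    (by rw [natDegree_mul (X_sub_C_ne_zero l) hp, natDegree_X_sub_C, hdeg, Finset.card_range,
      add_comm]) hinj (fun i hi => (hy i (Finset.mem_range.1 hi)).2.2)
  have hnd : ((X - C l) * p).roots.Nodup := by
    rw [hr]
    exact Multiset.Nodup.map_on (fun a ha b hb h => hinj ha hb h) (Finset.nodup _)
  have huniq : ∀ x, e j < x → x < e (j + 1) → x ∈ ((X - C l) * p).roots → x = y j := by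
    intro x h1 h2 hx
    rw [hr] at hx
    obtain ⟨i, hi, rfl⟩ := Multiset.mem_map.1 hx
    have hi := Finset.mem_range.1 hi
    rcases lt_trichotomy i j with h | h | h
    · exact absurd ((hy i hi).2.1.trans_le (le_of_forall_lt_succ he h hj.le)) h1.not_gt
    · rw [h]
    · exact absurd ((le_of_forall_lt_succ he h hi.le).trans_lt (hy i hi).1) h2.not_gt
  have hmem : y j ∈ ((X - C l) * p).roots := (mem_roots hg).2 (hy j hj).2.2
  -- The root multiset is `l` followed by the roots of `p`; having no repetition, it shows that `l`
  -- is not a root of `p`.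
  rw [roots_mul hg, roots_X_sub_C, Multiset.singleton_add] at hnd huniq hmem
  obtain ⟨hl, hnd⟩ := Multiset.nodup_cons.1 hnd
  by_cases h : l ∈ Set.Ioo (e j) (e (j + 1))
  · refine Or.inr ⟨h, Set.eq_empty_iff_forall_notMem.2 ?_⟩
    rintro x ⟨hx, hx'⟩
    have hx' := (mem_roots hp).2 hx'
    have h1 := huniq x hx.1 hx.2 (Multiset.mem_cons_of_mem hx')
    have h2 := huniq l h.1 h.2 (Multiset.mem_cons_self l _)
    exact hl (h2.trans h1.symm ▸ hx')
  · have hyl : y j ≠ l := fun hh => h (hh ▸ ⟨(hy j hj).1, (hy j hj).2.1⟩)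
    have hyp := (Multiset.mem_cons.1 hmem).resolve_left hyl
    refine Or.inl ⟨⟨y j, ?_, ?_⟩, h⟩
    · ext x
      constructor
      · rintro ⟨hx, hx'⟩
        exact huniq x hx.1 hx.2 (Multiset.mem_cons_of_mem ((mem_roots hp).2 hx'))
      · rintro rfl
        exact ⟨⟨(hy j hj).1, (hy j hj).2.1⟩, (mem_roots hp).1 hyp⟩
    · classical
      rw [← count_roots]
      exact Multiset.count_eq_one_of_mem hnd hyp

theorem isIncreasingZeros_of_strictMono {p : ℝ[X]} (hp : p ≠ 0) {m : ℕ}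
    (hdeg : p.natDegree = m) {z : Fin m → ℝ} (hz : StrictMono z) (h0 : ∀ i, p.eval (z i) = 0) :
    IsIncreasingZeros p z := by
  refine ⟨hdeg, hz, fun x => ?_⟩
  rw [← mem_roots hp, roots_eq_map_of_injOn hp Finset.univ (by simpa using hdeg)
    hz.injective.injOn (fun i _ => h0 i)]
  simp

theorem IsIncreasingZeros.unique {p : ℝ[X]} {m : ℕ} {z w : Fin m → ℝ}
    (hz : IsIncreasingZeros p z) (hw : IsIncreasingZeros p w) : z = w :=
  (hz.2.1.range_inj hw.2.1).1 (Set.ext fun x => (hz.2.2 x).symm.trans (hw.2.2 x))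

/-- If each of the intervals `(a, w 0), (w 0, w 1), …` contains either one zero of `p` or the
point `l`, then the zeros of `p` and `q` interlace exactly when `l` lies below all zeros `w`
of `q`. -/
theorem zerosInterlace_iff {p q : ℝ[X]} {n : ℕ} {w : Fin (n + 1) → ℝ} {a l : ℝ} (hp : p ≠ 0)
    (hdeg : p.natDegree = n) (hw : IsIncreasingZeros q w)
    (h0 : OneSimpleZeroOrPoint p l a (w 0))
    (hs : ∀ i : Fin n, OneSimpleZeroOrPoint p l (w i.castSucc) (w i.succ)) :
    ZerosInterlace p q ↔ l < w 0 := by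
  constructor
  · rintro ⟨m, x, w', hx, hw', hint⟩
    obtain rfl : m = n := hx.1.symm.trans hdeg
    obtain rfl := hw'.unique hw
    rcases h0 with ⟨⟨t, ht, -⟩, -⟩ | h
    · have ht' : t ∈ {y ∈ Set.Ioo a (w' 0) | p.IsRoot y} := ht ▸ rfl
      obtain ⟨i, rfl⟩ := (hx.2.2 t).1 ht'.2
      -- Interlacing puts every zero of `p` above `w' 0`, so the first interval must be the one
      -- containing `l`.
      exact absurd ht'.1.2 ((hw'.2.1.monotone (Fin.zero_le _)).trans_lt (hint i).1).not_gt
    · exact h.1.2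
  · intro hl
    have hex : ∀ i : Fin n, ∃ x, (w i.castSucc < x ∧ x < w i.succ) ∧ p.eval x = 0 := by
      intro i
      rcases hs i with ⟨⟨t, ht, -⟩, -⟩ | h
      · have ht' : t ∈ {y ∈ Set.Ioo (w i.castSucc) (w i.succ) | p.IsRoot y} := ht ▸ rfl
        exact ⟨t, ht'.1, ht'.2⟩
      · exact absurd h.1.1 (hl.trans_le (hw.2.1.monotone (Fin.zero_le _))).not_gt
    choose x hx using hex
    refine ⟨n, x, w, isIncreasingZeros_of_strictMono hp hdeg (fun i j hij => ?_)
      (fun i => (hx i).2), hw, fun i => (hx i).1⟩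
    exact ((hx i).1.2.trans_le (hw.2.1.monotone (by
      rw [Fin.le_def, Fin.val_succ, Fin.val_castSucc]
      exact hij))).trans (hx j).1.1

/-! ### Signs of `(x - l_n) P_n^{(α,β)}` and the main theorem. -/

theorem neg_one_lt_jacobiPoint {n : ℕ} {α β : ℝ} (hα : -1 < α) (hs : 0 < α + β + 1) :
    -1 < jacobiPoint n α β := by
  have hn : (0 : ℝ) ≤ n := by positivity
  have h1 : 0 < α + β + 2 * n + 2 := by linarith
  have h2 : 0 < α + β + 2 * n + 3 := by linarith
  have h3 : 0 < α + n + 1 := by linarith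
  unfold jacobiPoint
  have : 0 < 2 * ((n : ℝ) + 1) * (α + n + 1) / ((α + β + 2 * n + 2) * (α + β + 2 * n + 3)) := by
    positivity
  linarith

theorem jacobiPoly_ne_zero {α β : ℝ} (hα : -1 < α) (hs : 0 < α + β + 1) (n : ℕ) :
    jacobiPoly n α β ≠ 0 :=
  leadingCoeff_ne_zero.1 (leadingCoeff_jacobiPoly_pos hα hs n).ne'

/-- At a zero of `P_{n+1}^{(α,β+1)}` that is not one of `P_n^{(α,β)}`, the polynomials
`(x - l_n) P_n^{(α,β)}` and `P_n^{(α,β+1)}` have the same sign. -/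
theorem sub_jacobiPoint_mul_eval_sign {n : ℕ} {α β w ε : ℝ} (hα : -1 < α) (hβ : -1 < β)
    (hs : 0 < α + β + 1) (hw : (jacobiPoly (n + 1) α (β + 1)).eval w = 0)
    (hne : (jacobiPoly n α β).eval w ≠ 0) (hε : 0 < ε * (jacobiPoly n α (β + 1)).eval w) :
    0 < ε * ((X - C (jacobiPoint n α β)) * jacobiPoly n α β).eval w := by
  have hn : (0 : ℝ) ≤ n := by positivity
  have h1 : 0 < α + β + 2 * n + 2 := by linarith
  have h2 : 0 < α + β + 2 * n + 3 := by linarith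
  have h3 : 0 < (n : ℝ) + β + 1 := by linarith
  have h := jacobiPoly_mixed_recurrence hα hs n w
  rw [hw, mul_zero, sub_zero] at h
  have hl : w - jacobiPoint n α β ≠ 0 := by
    intro hl
    rw [hl, mul_zero, zero_mul] at h
    exact hne ((mul_eq_zero.1 h).resolve_left (by positivity))
  rw [eval_mul, eval_sub, eval_X, eval_C]
  have h4 : 0 < (w - jacobiPoint n α β) ^ 2 := by positivity
  refine pos_of_mul_pos_right (a := ((n : ℝ) + β + 1) * (α + β + 2 * n + 3)) ?_ (by positivity)
  have h5 : ((n : ℝ) + β + 1) * (α + β + 2 * n + 3) *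
      (ε * ((w - jacobiPoint n α β) * (jacobiPoly n α β).eval w)) =
      (α + β + 2 * n + 2) * (α + β + 2 * n + 3) / 2 * (w - jacobiPoint n α β) ^ 2 *
        (ε * (jacobiPoly n α (β + 1)).eval w) := by
    linear_combination ε * (w - jacobiPoint n α β) * h
  rw [h5]
  positivity

theorem theorem2p1 (n : ℕ) (α β : ℝ) (hα : -1 < α) (hβ : 0 < β)
    (hcommon : ∀ x : ℝ,
      ¬ ((jacobiPoly n α β).IsRoot x ∧ (jacobiPoly (n + 1) α (β + 1)).IsRoot x)) :
    (∃ w : Fin (n + 1) → ℝ, IsIncreasingZeros (jacobiPoly (n + 1) α (β + 1)) w) ∧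
    ∀ w : Fin (n + 1) → ℝ, IsIncreasingZeros (jacobiPoly (n + 1) α (β + 1)) w →
      (-1 < w 0 ∧ w (Fin.last n) < 1) ∧
      (OneSimpleZeroOrPoint (jacobiPoly n α β) (jacobiPoint n α β) (-1) (w 0) ∧
        ∀ i : Fin n, OneSimpleZeroOrPoint (jacobiPoly n α β) (jacobiPoint n α β)
          (w i.castSucc) (w i.succ)) ∧
      (ZerosInterlace (jacobiPoly n α β) (jacobiPoly (n + 1) α (β + 1)) ↔
        jacobiPoint n α β < w 0) := by
  have hs : 0 < α + β + 1 := by linarith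
  have hs' : 0 < α + (β + 1) + 1 := by linarith
  obtain ⟨z, hz, hmono⟩ :=
    (isSturmSequence_jacobiPoly hα (by linarith : -1 < β + 1) hs').exists_roots n
  have hzz : IsIncreasingZeros (jacobiPoly (n + 1) α (β + 1)) (fun i : Fin (n + 1) => z i) :=
    isIncreasingZeros_of_strictMono (jacobiPoly_ne_zero hα hs' _) (natDegree_jacobiPoly hα hs' _)
      (fun i j hij => lt_of_forall_lt_succ (m := n) (fun i hi => hmono i (by omega)) hij
        (by omega)) (fun i => (hz i i.2).2.2.1)
  refine ⟨⟨_, hzz⟩, fun w hw => ?_⟩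
  obtain rfl := hzz.unique hw
  let e : ℕ → ℝ := fun j => Nat.casesOn j (-1) z
  have he : ∀ i < n + 1, e i < e (i + 1) := by
    rintro (_ | i) hi
    · exact (hz 0 hi).1
    · exact hmono i hi
  obtain ⟨y, hy⟩ := exists_roots_of_alternating
    ((X - C (jacobiPoint n α β)) * jacobiPoly n α β) (N := n + 1) he (by
      rintro (_ | i) hi
      -- At `-1` the factor `x - l_n` is negative and supplies the extra sign.
      · change 0 < (-1) ^ (n + 1) * eval (-1) _
        rw [eval_mul, eval_sub, eval_X, eval_C, pow_succ]
        have h1 := eval_neg_one_jacobiPoly_sign hα (by linarith : -1 < β) hs n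
        have h2 := sub_pos.2 (neg_one_lt_jacobiPoint (n := n) hα hs)
        have h3 := mul_pos h2 h1
        linarith
      · have hi : i < n + 1 := hi
        obtain ⟨-, -, h1, h2⟩ := hz i hi
        refine sub_jacobiPoint_mul_eval_sign hα (by linarith) hs h1
          (fun h => hcommon _ ⟨h, h1⟩) ?_
        rwa [show n + 1 + (i + 1) = n + i + 2 by ring, pow_add, neg_one_sq, mul_one])
  have hp := jacobiPoly_ne_zero hα hs n
  have hdeg := natDegree_jacobiPoly hα hs n
  have hone : ∀ j < n + 1, OneSimpleZeroOrPoint (jacobiPoly n α β) (jacobiPoint n α β)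
      (e j) (e (j + 1)) := fun j hj => oneSimpleZeroOrPoint_of_roots hp hdeg he hy hj
  have h0 := hone 0 n.succ_pos
  have hsucc : ∀ i : Fin n, OneSimpleZeroOrPoint (jacobiPoly n α β) (jacobiPoint n α β)
      (z i.castSucc) (z i.succ) := fun i => hone (i + 1) (by omega)
  exact ⟨⟨(hz 0 n.succ_pos).1, (hz n n.lt_succ_self).2.1⟩, ⟨h0, hsucc⟩,
    zerosInterlace_iff hp hdeg hw h0 hsucc⟩
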